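/- Let $n\ge 1$ and $0\le d\le n-1$ be integers. Let $\Delta_{n-1}=\{u\in\mathbb{R}^n : u_i\ge 0 \text{ for all } i,\ \sum_{i=1}^n u_i=1\}$ be the probability simplex. A $d$-dimensional linear model in $\Delta_{n-1}$ is a set $\mathcal{M}=L\cap\Delta_{n-1}$, where $L\subseteq\{x\in\mathbb{R}^n:\sum_{i=1}^n x_i=1\}$ is a $d$-dimensional affine subspace containing a point with all coordinates positive. A point $p\in\mathcal{M}$ is called interior if $p_i>0$ for all $i$. For $p\in\mathcal{M}$, the logarithmic Voronoi cell of $\mathcal{M}$ at $p$ is $$\log\mathrm{Vor}_{\mathcal{M}}(p)=\Big\{u\in\Delta_{n-1} : \ell_u(p)=\max_{q\in\mathcal{M}}\ell_u(q)\Big\},\qquad \ell_u(x)=\sum_{i=1}^n u_i\log x_i,$$ where $\log 0=-\infty$ and $0\cdot(-\infty)=0$. Two polytopes are combinatorially equivalent if their face lattices are isomorphic. Let $P$ be a convex polytope in some $\mathbb{R}^m$ (the convex hull of a nonempty finite set) of dimension $n-d-1$ with at most $n$ facets. Then there exist a $d$-dimensional linear model $\mathcal{M}$ in $\Delta_{n-1}$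 and an interior point $p\in\mathcal{M}$ such that $\log\mathrm{Vor}_{\mathcal{M}}(p)$ is a polytope that is combinatorially equivalent to $P$. -/

import Mathlib

/-- A (convex) polytope in a real vector space: the convex hull of a nonempty finite set. -/
def IsPolytope {E : Type*} [AddCommGroup E] [Module ℝ E] (P : Set E) : Prop :=
  ∃ s : Finset E, s.Nonempty ∧ P = convexHull ℝ (s : Set E)

/-- The dimension of a nonempty set: the dimension of its affine span. -/
noncomputable def polyDim {E : Type*} [AddCommGroup E] [Module ℝ E] (P : Set E) : ℕ :=
  Module.finrank ℝ (vectorSpan ℝ P)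

/-- A face of `P`: the subset of `P` where a linear inequality valid on `P` holds with equality.
Both `∅` and `P` itself are faces. -/
def IsPolyFace {E : Type*} [AddCommGroup E] [Module ℝ E] (P F : Set E) : Prop :=
  ∃ (l : E →ₗ[ℝ] ℝ) (c : ℝ), (∀ x ∈ P, l x ≤ c) ∧ F = {x ∈ P | l x = c}

/-- A facet: a (nonempty) face whose dimension is one less than the dimension of `P`. -/
def IsPolyFacet {E : Type*} [AddCommGroup E] [Module ℝ E] (P F : Set E) : Prop :=
  IsPolyFace P F ∧ F.Nonempty ∧ polyDim F + 1 = polyDim P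

/-- Combinatorial equivalence: the face lattices, ordered by inclusion, are isomorphic. -/
def CombEquiv {E E' : Type*} [AddCommGroup E] [Module ℝ E] [AddCommGroup E'] [Module ℝ E']
    (P : Set E) (Q : Set E') : Prop :=
  Nonempty ({F : Set E // IsPolyFace P F} ≃o {G : Set E' // IsPolyFace Q G})

/-- `M` is a `d`-dimensional discrete linear model inside the probability simplex in `ℝⁿ`:
it is parametrized by an injective map `f = (f₁, …, fₙ)` whose coordinates are polynomials of
degree at most one in `d` parameters with `∑ fᵢ = 1`, restricted to the parameter polytope
`{θ | fᵢ(θ) ≥ 0 for all i}`, which has an interior point with all `fᵢ` positive (so that the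
parameter space is `d`-dimensional). -/
def IsLinearModel {n : ℕ} (d : ℕ) (M : Set (Fin n → ℝ)) : Prop :=
  ∃ f : (Fin d → ℝ) →ᵃ[ℝ] (Fin n → ℝ),
    Function.Injective f ∧ (∀ θ, ∑ i, f θ i = 1) ∧ (∃ θ, ∀ i, 0 < f θ i) ∧
      M = f '' {θ | ∀ i, 0 ≤ f θ i}

/-- The log-likelihood function `ℓ_u(x) = ∑ uᵢ log xᵢ` on nonnegative vectors, with values in
`[-∞, ∞]`: here `log 0 = -∞`, `0 * (-∞) = 0`, and a sum with a summand `-∞` is `-∞`. -/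
noncomputable def logLikelihood {n : ℕ} (u x : Fin n → ℝ) : EReal :=
  ∑ i, (u i : EReal) * ENNReal.log (ENNReal.ofReal (x i))

/-- The logarithmic Voronoi cell at a point `p` of the model `M`: all distributions `u` for which
`p` is a maximum likelihood estimate in `M`. -/
def logVoronoi {n : ℕ} (M : Set (Fin n → ℝ)) (p : Fin n → ℝ) : Set (Fin n → ℝ) :=
  {u ∈ stdSimplex ℝ (Fin n) | p ∈ M ∧ IsMaxOn (logLikelihood u) M p}

/-!
A `k`-dimensional polytope `P` is affinely isomorphic to a full-dimensional polytope `Q` in a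
Euclidean space `E` of dimension `k` with the origin in its interior
(`IsPolytope.exists_fullDimensional`). If `P` has at most `n` facets, then
`Q = {y | ⟪y, aᵢ⟫ ≤ 1, i = 1, …, n}`, where the `aᵢ` are the extreme points of the polar of `Q`,
padded by zeros (`exists_inequalities`). Indeed, the constraints that are tight at an extreme point
of the polar span `E`, so for `k > 0` distinct extreme points give distinct facets of `Q` (for
`k = 0` the only extreme point is the origin); and `Q` is recovered from the extreme points by the
Krein–Milman theorem and the separation theorem.

The origin lies in the interior of the polar, which is the convex hull of the `aᵢ`, so
`∑ pᵢ aᵢ = 0` for some positive `p` with `∑ pᵢ = 1` (`exists_pos_weights_of_zero_mem_interior`).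
Let `M` be the model through `p` whose directions `v` are the affine dependences of the
configuration: `∑ vᵢ = 0` and `∑ vᵢ aᵢ = 0`. These form a space of dimension `n - k - 1`. By
concavity of the logarithm, `u` is in the logarithmic Voronoi cell at `p` exactly when `(uᵢ / pᵢ)`
is orthogonal to all affine dependences (`isMaxOn_logLikelihood_iff`), that is, when
`uᵢ = pᵢ (t - ⟪y, aᵢ⟫)` for some real `t` and some `y : E`. The condition `∑ uᵢ = 1` forces `t = 1`
because of the choice of `p`, and `u ≥ 0` then says that `y ∈ Q`. So the cell is the image of `Q`
under an injective affine map (`logVoronoi_eq_image_slackMap`), and such maps preserve face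
lattices (`combEquiv_affineImage`).
-/

/-! ### Faces under injective affine maps -/

section AffineImage

variable {E E' : Type*} [AddCommGroup E] [Module ℝ E] [AddCommGroup E'] [Module ℝ E']

theorem IsPolyFace.subset {P F : Set E} (h : IsPolyFace P F) : F ⊆ P := by
  obtain ⟨l, c, -, rfl⟩ := h
  exact Set.sep_subset _ _

theorem IsPolytope.affineImage {P : Set E} (hP : IsPolytope P) (g : E →ᵃ[ℝ] E') :
    IsPolytope (g '' P) := by
  classical
  obtain ⟨s, hs, rfl⟩ := hP
  exact ⟨s.image g, hs.image g, by rw [g.image_convexHull, Finset.coe_image]⟩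

theorem polyDim_affineImage (g : E →ᵃ[ℝ] E') (hg : Function.Injective g) (P : Set E) :
    polyDim (g '' P) = polyDim P := by
  unfold polyDim
  rw [← AffineMap.map_vectorSpan]
  exact (LinearEquiv.finrank_eq (Submodule.equivMapOfInjective g.linear
    ((g.linear_injective_iff).2 hg) _)).symm

theorem isPolyFace_affineImage (g : E →ᵃ[ℝ] E') (hg : Function.Injective g) {P F : Set E} :
    IsPolyFace (g '' P) (g '' F) ↔ IsPolyFace P F := by
  constructor
  · rintro ⟨l, c, hl, hF⟩
    have key : ∀ x, l (g x) = l (g.linear x) + l (g 0) := fun x => by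
      have h1 : g x = g.linear x + g 0 := by
        have := g.map_vadd 0 x
        simpa using this
      rw [← map_add, ← h1]
    refine ⟨l ∘ₗ g.linear, c - l (g 0), fun x hx => ?_, ?_⟩
    · have := hl _ (Set.mem_image_of_mem g hx)
      rw [key] at this
      simp only [LinearMap.comp_apply]
      linarith
    · ext x
      have : x ∈ F ↔ g x ∈ g '' F := (hg.mem_set_image).symm
      rw [this, hF, Set.mem_sep_iff, hg.mem_set_image, key]
      simp only [Set.mem_sep_iff, LinearMap.comp_apply, eq_sub_iff_add_eq]
  · rintro ⟨l, c, hl, rfl⟩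
    obtain ⟨L, hL⟩ := g.linear.exists_leftInverse_of_injective
      (LinearMap.ker_eq_bot.2 ((g.linear_injective_iff).2 hg))
    have key : ∀ x, (l ∘ₗ L) (g x) = l x + l (L (g 0)) := fun x => by
      have h1 : g x = g.linear x + g 0 := by
        have := g.map_vadd 0 x
        simpa using this
      have h2 : L (g.linear x) = x := LinearMap.congr_fun hL x
      simp [h1, h2]
    refine ⟨l ∘ₗ L, c + l (L (g 0)), ?_, ?_⟩
    · rintro _ ⟨x, hx, rfl⟩
      rw [key]
      linarith [hl x hx]
    · ext y
      constructor
      · rintro ⟨x, ⟨hx, hc⟩, rfl⟩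
        exact ⟨Set.mem_image_of_mem g hx, by rw [key, hc]⟩
      · rintro ⟨⟨x, hx, rfl⟩, hc⟩
        rw [key] at hc
        exact ⟨x, ⟨hx, by linarith⟩, rfl⟩

theorem isPolyFacet_affineImage (g : E →ᵃ[ℝ] E') (hg : Function.Injective g) {P F : Set E} :
    IsPolyFacet (g '' P) (g '' F) ↔ IsPolyFacet P F := by
  simp only [IsPolyFacet, isPolyFace_affineImage g hg, Set.image_nonempty,
    polyDim_affineImage g hg]

theorem combEquiv_affineImage (g : E →ᵃ[ℝ] E') (hg : Function.Injective g) (P : Set E) :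
    CombEquiv P (g '' P) := by
  have inv : ∀ G : {G : Set E' // IsPolyFace (g '' P) G}, g '' (g ⁻¹' G.1) = G.1 := fun G =>
    Set.image_preimage_eq_of_subset (G.2.subset.trans (Set.image_subset_range g P))
  refine ⟨{
    toFun := fun F => ⟨g '' F.1, (isPolyFace_affineImage g hg).2 F.2⟩
    invFun := fun G => ⟨g ⁻¹' G.1, (isPolyFace_affineImage g hg).1 ((inv G).symm ▸ G.2)⟩
    left_inv := fun F => Subtype.ext (Set.preimage_image_eq _ hg)
    right_inv := fun G => Subtype.ext (inv G)
    map_rel_iff' := ?_ }⟩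
  intro F G
  exact Set.image_subset_image_iff hg

theorem CombEquiv.symm {P : Set E} {Q : Set E'} (h : CombEquiv P Q) : CombEquiv Q P :=
  h.map OrderIso.symm

theorem CombEquiv.trans {E'' : Type*} [AddCommGroup E''] [Module ℝ E''] {P : Set E} {Q : Set E'}
    {R : Set E''} (h : CombEquiv P Q) (h' : CombEquiv Q R) : CombEquiv P R :=
  h.elim fun e => h'.map e.trans

theorem encard_facets_le_affineImage (g : E →ᵃ[ℝ] E') (hg : Function.Injective g) (P : Set E) :
    {F | IsPolyFacet P F}.encard ≤ {F | IsPolyFacet (g '' P) F}.encard :=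
  Set.encard_le_encard_of_injOn (f := fun F => g '' F)
    (fun _ hF => (isPolyFacet_affineImage g hg).2 hF) (hg.image_injective.injOn)

end AffineImage

/-- Every polytope is the injective affine image of a full-dimensional polytope in a Euclidean
space that contains the origin in its interior. -/
theorem IsPolytope.exists_fullDimensional {E : Type*} [AddCommGroup E] [Module ℝ E] {P : Set E}
    (hP : IsPolytope P) :
    ∃ (g : EuclideanSpace ℝ (Fin (polyDim P)) →ᵃ[ℝ] E)
      (t : Finset (EuclideanSpace ℝ (Fin (polyDim P)))),
      Function.Injective g ∧ P = g '' convexHull ℝ (t : Set (EuclideanSpace ℝ (Fin (polyDim P)))) ∧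
        0 ∈ interior (convexHull ℝ (t : Set (EuclideanSpace ℝ (Fin (polyDim P))))) := by
  classical
  obtain ⟨s, ⟨x, hx⟩, hPs⟩ := hP
  have hspan : vectorSpan ℝ P = vectorSpan ℝ (s : Set E) := by
    rw [hPs, ← direction_affineSpan, affineSpan_convexHull, direction_affineSpan]
  have hfd : FiniteDimensional ℝ (vectorSpan ℝ P) := by
    rw [hspan]
    exact finiteDimensional_vectorSpan_of_finite ℝ s.finite_toSet
  let V := EuclideanSpace ℝ (Fin (polyDim P))
  have hV : Module.finrank ℝ V = polyDim P := finrank_euclideanSpace_fin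
  have e : V ≃ₗ[ℝ] vectorSpan ℝ P := LinearEquiv.ofFinrankEq _ _ hV
  let g₀ : V →ᵃ[ℝ] E := ((vectorSpan ℝ P).subtype ∘ₗ e.toLinearMap).toAffineMap +
    AffineMap.const ℝ V x
  have hg₀ : ∀ y, g₀ y = (e y : E) + x := fun y => rfl
  have hinj₀ : Function.Injective g₀ := fun y z h => by
    rw [hg₀, hg₀] at h
    exact e.injective (Subtype.ext (add_right_cancel h))
  have hrange : ∀ y ∈ s, ∃ v, g₀ v = y := fun y hy => by
    have hmem : y - x ∈ vectorSpan ℝ P := by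
      rw [hspan]
      exact vsub_mem_vectorSpan ℝ (Finset.mem_coe.2 hy) (Finset.mem_coe.2 hx)
    exact ⟨e.symm ⟨y - x, hmem⟩, by rw [hg₀, e.apply_symm_apply, sub_add_cancel]⟩
  have hcover : ∀ g : V →ᵃ[ℝ] E, (∀ y ∈ s, ∃ v, g v = y) →
      g '' convexHull ℝ (g ⁻¹' (s : Set E)) = P := fun g hg => by
    rw [g.image_convexHull, Set.image_preimage_eq_of_subset, hPs]
    intro y hy
    exact hg y hy
  have hint : (interior (convexHull ℝ (g₀ ⁻¹' (s : Set E)))).Nonempty := by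
    rw [(convex_convexHull ℝ _).interior_nonempty_iff_affineSpan_eq_top]
    have hne : (convexHull ℝ (g₀ ⁻¹' (s : Set E))).Nonempty := by
      obtain ⟨v, hv⟩ := hrange x hx
      exact ⟨v, subset_convexHull ℝ _ (by simpa [hv] using hx)⟩
    rw [← AffineSubspace.direction_eq_top_iff_of_nonempty (hne.affineSpan ℝ), direction_affineSpan]
    apply Submodule.eq_top_of_finrank_eq
    have h := polyDim_affineImage g₀ hinj₀ (convexHull ℝ (g₀ ⁻¹' (s : Set E)))
    rw [hcover g₀ hrange] at h
    exact h.symm.trans hV.symm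
  obtain ⟨z, hz⟩ := hint
  -- translate the origin to the interior point `z`
  let g : V →ᵃ[ℝ] E := g₀.comp (AffineEquiv.vaddConst ℝ z).toAffineMap
  have hg : ∀ y, g y = g₀ (y + z) := fun y => rfl
  have hinj : Function.Injective g := fun y w h => by
    rw [hg, hg] at h
    exact add_right_cancel (hinj₀ h)
  have hrange' : ∀ y ∈ s, ∃ v, g v = y := fun y hy => by
    obtain ⟨v, hv⟩ := hrange y hy
    exact ⟨v - z, by rw [hg, sub_add_cancel, hv]⟩
  have hfin : (g ⁻¹' (s : Set E)).Finite := s.finite_toSet.preimage hinj.injOn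
  have hQ : convexHull ℝ (g ⁻¹' (s : Set E)) =
      (Homeomorph.addRight z) ⁻¹' convexHull ℝ (g₀ ⁻¹' (s : Set E)) := by
    ext y
    rw [← hinj.mem_set_image, (hcover g hrange').trans (hcover g₀ hrange).symm, hg,
      hinj₀.mem_set_image]
    rfl
  refine ⟨g, hfin.toFinset, hinj, ?_, ?_⟩
  · rw [hfin.coe_toFinset, hcover g hrange']
  · rw [hfin.coe_toFinset, hQ, ← Homeomorph.preimage_interior]
    simpa using hz

/-! ### The polar of a polytope -/

section Polar

open scoped InnerProductSpace

variable {E : Type*} [NormedAddCommGroup E] [InnerProductSpace ℝ E]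

/-- The polar of a finite set `t` (equivalently, of its convex hull), as a subset of the Euclidean
space itself: all `a` with `⟪v, a⟫ ≤ 1` for every `v ∈ t`. -/
def finsetPolar (t : Finset E) : Set E := {a | ∀ v ∈ t, ⟪v, a⟫_ℝ ≤ 1}

theorem convex_finsetPolar (t : Finset E) : Convex ℝ (finsetPolar t) := by
  intro a ha b hb r s hr hs hrs v hv
  rw [inner_add_right, inner_smul_right, inner_smul_right]
  nlinarith [mul_le_mul_of_nonneg_left (ha v hv) hr, mul_le_mul_of_nonneg_left (hb v hv) hs]

theorem isClosed_finsetPolar (t : Finset E) : IsClosed (finsetPolar t) := by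
  simp only [finsetPolar, Set.ofPred_forall]
  exact isClosed_biInter fun v _ => isClosed_le (by fun_prop) continuous_const

theorem zero_mem_interior_finsetPolar (t : Finset E) : 0 ∈ interior (finsetPolar t) := by
  rw [mem_interior_iff_mem_nhds]
  have : ∀ᶠ a in nhds (0 : E), ∀ v ∈ t, ⟪v, a⟫_ℝ < 1 := by
    rw [Filter.eventually_all_finset]
    intro v _
    have hc : ContinuousAt (fun a : E => ⟪v, a⟫_ℝ) 0 := by fun_prop
    exact hc.eventually_lt_const (by simp)
  filter_upwards [this] with a ha v hv using (ha v hv).le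

theorem inner_le_one_of_mem_convexHull {t : Finset E} {a : E} (ha : a ∈ finsetPolar t) {x : E}
    (hx : x ∈ convexHull ℝ (t : Set E)) : ⟪x, a⟫_ℝ ≤ 1 := by
  have hconv : Convex ℝ {x : E | ⟪x, a⟫_ℝ ≤ 1} := by
    intro x hx y hy r s hr hs hrs
    simp only [Set.mem_ofPred_eq] at *
    rw [inner_add_left, inner_smul_left, inner_smul_left]
    simp only [conj_trivial]
    nlinarith [mul_le_mul_of_nonneg_left hx hr, mul_le_mul_of_nonneg_left hy hs]
  exact convexHull_min (fun v hv => ha v hv) hconv hx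

theorem isCompact_finsetPolar [FiniteDimensional ℝ E] {t : Finset E}
    (h0 : 0 ∈ interior (convexHull ℝ (t : Set E))) : IsCompact (finsetPolar t) := by
  refine Metric.isCompact_of_isClosed_isBounded (isClosed_finsetPolar t) ?_
  obtain ⟨r, hr, hball⟩ := Metric.mem_nhds_iff.1 (mem_interior_iff_mem_nhds.1 h0)
  refine isBounded_iff_forall_norm_le.2 ⟨2 / r, fun a ha => ?_⟩
  rcases eq_or_ne a 0 with rfl | hne
  · simp only [norm_zero]; positivity
  have hn : 0 < ‖a‖ := norm_pos_iff.2 hne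
  -- test `a` against the point of norm `r / 2` in its own direction
  have hmem : (r / 2 / ‖a‖) • a ∈ convexHull ℝ (t : Set E) := by
    apply hball
    rw [mem_ball_zero_iff, norm_smul, Real.norm_of_nonneg (by positivity),
      div_mul_cancel₀ _ hn.ne']
    linarith
  have h := inner_le_one_of_mem_convexHull ha hmem
  rw [inner_smul_left, real_inner_self_eq_norm_sq] at h
  simp only [conj_trivial] at h
  rw [le_div_iff₀ hr]
  have : r / 2 / ‖a‖ * ‖a‖ ^ 2 = r / 2 * ‖a‖ := by field_simp
  linarith

theorem convexHull_extremePoints_finsetPolar_dense [FiniteDimensional ℝ E] {t : Finset E}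
    (h0 : 0 ∈ interior (convexHull ℝ (t : Set E))) :
    closure (convexHull ℝ ((finsetPolar t).extremePoints ℝ)) = finsetPolar t :=
  closure_convexHull_extremePoints (isCompact_finsetPolar h0) (convex_finsetPolar t)

/-- The bipolar theorem: a polytope around the origin is cut out by the extreme points of its
polar. -/
theorem mem_convexHull_iff_inner_extremePoints_le_one [FiniteDimensional ℝ E] {t : Finset E}
    (h0 : 0 ∈ interior (convexHull ℝ (t : Set E))) {x : E} :
    x ∈ convexHull ℝ (t : Set E) ↔ ∀ a ∈ (finsetPolar t).extremePoints ℝ, ⟪x, a⟫_ℝ ≤ 1 := by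
  refine ⟨fun hx a ha => inner_le_one_of_mem_convexHull (extremePoints_subset ha) hx,
    fun hx => ?_⟩
  have hall : ∀ a ∈ finsetPolar t, ⟪x, a⟫_ℝ ≤ 1 := by
    have hconv : Convex ℝ {a : E | ⟪x, a⟫_ℝ ≤ 1} := by
      simpa [finsetPolar] using convex_finsetPolar {x}
    have hcl : IsClosed {a : E | ⟪x, a⟫_ℝ ≤ 1} := by
      simpa [finsetPolar] using isClosed_finsetPolar {x}
    intro a ha
    rw [← convexHull_extremePoints_finsetPolar_dense h0] at ha
    exact closure_minimal (convexHull_min (fun a ha => hx a ha) hconv) hcl ha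
  by_contra hnot
  obtain ⟨f, s, hfs, hsx⟩ := geometric_hahn_banach_closed_point (convex_convexHull ℝ (t : Set E))
    (t.finite_toSet.isClosed_convexHull ℝ) hnot
  have hs : 0 < s := by simpa using hfs 0 (interior_subset h0)
  -- normalize the separating functional to have level `1`
  let a : E := s⁻¹ • (InnerProductSpace.toDual ℝ E).symm f
  have hin : ∀ y, ⟪y, a⟫_ℝ = s⁻¹ * f y := fun y => by
    rw [inner_smul_right, real_inner_comm, InnerProductSpace.toDual_symm_apply]
  have h1 := hall a fun v hv => by
    rw [hin, inv_mul_le_iff₀ hs, mul_one]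
    exact (hfs v (subset_convexHull ℝ _ hv)).le
  rw [hin, inv_mul_le_iff₀ hs, mul_one] at h1
  exact absurd hsx h1.not_gt

/-- At an extreme point of the polar the tight constraints have full rank: otherwise a small
perturbation orthogonal to them stays inside the polar in both directions. -/
theorem span_tight_eq_top_of_mem_extremePoints [FiniteDimensional ℝ E] {t : Finset E} {a : E}
    (ha : a ∈ (finsetPolar t).extremePoints ℝ) :
    Submodule.span ℝ {v | v ∈ t ∧ ⟪v, a⟫_ℝ = 1} = ⊤ := by
  rw [← Submodule.orthogonal_eq_bot_iff, Submodule.eq_bot_iff]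
  intro b hb
  by_contra hb0
  have hort : ∀ v ∈ t, ⟪v, a⟫_ℝ = 1 → ⟪v, b⟫_ℝ = 0 := fun v hv hva =>
    (Submodule.mem_orthogonal _ _).1 hb v (Submodule.subset_span ⟨hv, hva⟩)
  have hev : ∀ᶠ ε in nhds (0 : ℝ), ∀ v ∈ t, ⟪v, a + ε • b⟫_ℝ ≤ 1 := by
    rw [Filter.eventually_all_finset]
    intro v hv
    rcases (extremePoints_subset ha v hv).eq_or_lt with h | h
    · exact Filter.Eventually.of_forall fun ε => by
        rw [inner_add_right, inner_smul_right, hort v hv h, h]; simp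
    · have hc : ContinuousAt (fun ε : ℝ => ⟪v, a + ε • b⟫_ℝ) 0 := by fun_prop
      exact (hc.eventually_lt_const (by simpa using h)).mono fun ε => le_of_lt
  obtain ⟨r, hr, hball⟩ := Metric.eventually_nhds_iff_ball.1 hev
  have hp := hball (r / 2) (by rw [mem_ball_zero_iff, Real.norm_of_nonneg] <;> linarith)
  have hm := hball (-(r / 2)) (by rw [mem_ball_zero_iff, norm_neg, Real.norm_of_nonneg] <;> linarith)
  have := (mem_extremePoints.1 ha).2 _ hp _ hm
    ⟨1 / 2, 1 / 2, by norm_num, by norm_num, by norm_num, by module⟩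
  have h0 : (r / 2) • b = 0 := by simpa using this.1
  exact (smul_ne_zero (by positivity) hb0) h0

/-- For an extreme point `a` of the polar, the points with `⟪x, a⟫ = 1` form a facet. -/
theorem isPolyFacet_of_mem_extremePoints_finsetPolar [FiniteDimensional ℝ E] [Nontrivial E]
    {t : Finset E} (h0 : 0 ∈ interior (convexHull ℝ (t : Set E))) {a : E}
    (ha : a ∈ (finsetPolar t).extremePoints ℝ) :
    IsPolyFacet (convexHull ℝ (t : Set E)) {x ∈ convexHull ℝ (t : Set E) | ⟪x, a⟫_ℝ = 1} := by
  set F := {x ∈ convexHull ℝ (t : Set E) | ⟪x, a⟫_ℝ = 1} with hF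
  have hspan := span_tight_eq_top_of_mem_extremePoints ha
  have hsub : {v | v ∈ t ∧ ⟪v, a⟫_ℝ = 1} ⊆ F := fun v hv => ⟨subset_convexHull ℝ _ hv.1, hv.2⟩
  obtain ⟨v₀, hv₀⟩ : {v | v ∈ t ∧ ⟪v, a⟫_ℝ = 1}.Nonempty := by
    rw [Set.nonempty_iff_ne_empty]
    intro h
    rw [h, Submodule.span_empty] at hspan
    exact bot_ne_top hspan
  have ha0 : a ≠ 0 := by
    rintro rfl
    simpa using hv₀.2
  refine ⟨⟨(innerₗ E) a, 1, fun x hx => ?_, ?_⟩, ⟨v₀, hsub hv₀⟩, ?_⟩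
  · rw [innerₗ_apply_apply, real_inner_comm]
    exact inner_le_one_of_mem_convexHull (extremePoints_subset ha) hx
  · ext x
    simp only [hF, Set.mem_sep_iff, innerₗ_apply_apply, real_inner_comm]
  · have hfull : polyDim (convexHull ℝ (t : Set E)) = Module.finrank ℝ E := by
      have := (convex_convexHull ℝ (t : Set E)).interior_nonempty_iff_affineSpan_eq_top.1 ⟨0, h0⟩
      rw [polyDim, ← direction_affineSpan, this, AffineSubspace.direction_top, finrank_top]
    rw [hfull]
    apply le_antisymm
    · -- `F` lies in a hyperplane
      have hle : vectorSpan ℝ F ≤ (ℝ ∙ a)ᗮ := by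
        refine Submodule.span_le.2 ?_
        rintro _ ⟨x, hx, y, hy, rfl⟩
        change x - y ∈ (ℝ ∙ a)ᗮ
        rw [Submodule.mem_orthogonal_singleton_iff_inner_left, inner_sub_left, hx.2, hy.2, sub_self]
      have h1 := Submodule.finrank_mono hle
      have h2 := Submodule.finrank_add_finrank_orthogonal (ℝ ∙ a)
      rw [finrank_span_singleton ha0] at h2
      unfold polyDim
      omega
    · -- `F` together with the origin spans the space
      have hle : (⊤ : Submodule ℝ E) ≤ vectorSpan ℝ F ⊔ (ℝ ∙ v₀) := by
        rw [← hspan, Submodule.span_le]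
        intro v hv
        have h1 : v - v₀ ∈ vectorSpan ℝ F := vsub_mem_vectorSpan ℝ (hsub hv) (hsub hv₀)
        have : v = (v - v₀) + v₀ := by abel
        rw [this]
        exact Submodule.add_mem_sup h1 (Submodule.mem_span_singleton_self v₀)
      have h1 := Submodule.finrank_mono hle
      have h2 := Submodule.finrank_add_le_finrank_add_finrank (vectorSpan ℝ F) (ℝ ∙ v₀)
      have h3 := finrank_span_le_card (R := ℝ) ({v₀} : Set E)
      simp only [Set.toFinset_singleton, Finset.card_singleton] at h3
      rw [finrank_top] at h1
      unfold polyDim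
      omega

theorem encard_extremePoints_finsetPolar_le [FiniteDimensional ℝ E] {t : Finset E}
    (h0 : 0 ∈ interior (convexHull ℝ (t : Set E))) {n : ℕ} (hn : 1 ≤ n)
    (hfacets : {F | IsPolyFacet (convexHull ℝ (t : Set E)) F}.encard ≤ n) :
    ((finsetPolar t).extremePoints ℝ).encard ≤ n := by
  rcases subsingleton_or_nontrivial E with hE | hE
  · -- in dimension zero there are no facets, and the origin is the only candidate
    exact (Set.encard_le_one_iff.2 fun a b _ _ => Subsingleton.elim a b).trans
      (by exact_mod_cast hn)
  refine le_trans (Set.encard_le_encard_of_injOn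
    (f := fun a => {x ∈ convexHull ℝ (t : Set E) | ⟪x, a⟫_ℝ = 1})
    (fun a ha => isPolyFacet_of_mem_extremePoints_finsetPolar h0 ha) ?_) hfacets
  intro a ha b hb hab
  have h1 : ∀ v ∈ {v | v ∈ t ∧ ⟪v, a⟫_ℝ = 1}, ⟪v, a - b⟫_ℝ = 0 := fun v hv => by
    have hmem : v ∈ {x ∈ convexHull ℝ (t : Set E) | ⟪x, a⟫_ℝ = 1} :=
      ⟨subset_convexHull ℝ _ hv.1, hv.2⟩
    simp only at hab
    rw [hab] at hmem
    rw [inner_sub_right, hv.2, hmem.2, sub_self]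
  have h2 : a - b ∈ (Submodule.span ℝ {v | v ∈ t ∧ ⟪v, a⟫_ℝ = 1})ᗮ := by
    have : Submodule.span ℝ {v | v ∈ t ∧ ⟪v, a⟫_ℝ = 1} ≤ (ℝ ∙ (a - b))ᗮ :=
      Submodule.span_le.2 fun v hv =>
        Submodule.mem_orthogonal_singleton_iff_inner_left.2 (h1 v hv)
    exact Submodule.orthogonal_le this (Submodule.le_orthogonal_orthogonal _
      (Submodule.mem_span_singleton_self _))
  rw [span_tight_eq_top_of_mem_extremePoints ha, Submodule.top_orthogonal_eq_bot,
    Submodule.mem_bot] at h2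
  exact sub_eq_zero.1 h2

/-- A polytope around the origin with at most `n` facets is cut out by `n` inequalities
`⟪x, aᵢ⟫ ≤ 1` whose normals have the origin in the interior of their convex hull. Trivial
inequalities (`aᵢ = 0`) make up for missing facets. -/
theorem exists_inequalities [FiniteDimensional ℝ E] {t : Finset E}
    (h0 : 0 ∈ interior (convexHull ℝ (t : Set E))) {n : ℕ} (hn : 1 ≤ n)
    (hfacets : {F | IsPolyFacet (convexHull ℝ (t : Set E)) F}.encard ≤ n) :
    ∃ a : Fin n → E, convexHull ℝ (t : Set E) = {x | ∀ i, ⟪x, a i⟫_ℝ ≤ 1} ∧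
      0 ∈ interior (convexHull ℝ (Set.range a)) := by
  classical
  set X := (finsetPolar t).extremePoints ℝ with hX
  have hcard := encard_extremePoints_finsetPolar_le h0 hn hfacets
  have hfin : X.Finite := Set.finite_of_encard_le_coe hcard
  have := hfin.fintype
  obtain ⟨e⟩ : Nonempty (X ↪ Fin n) := by
    apply Function.Embedding.nonempty_of_card_le
    rw [Fintype.card_fin, ← Nat.card_eq_fintype_card]
    rw [hfin.encard_eq_coe_toFinset_card] at hcard
    rw [Nat.card_coe_set_eq, Set.ncard_eq_toFinset_card X hfin]
    exact_mod_cast hcard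
  let a : Fin n → E := Function.extend e Subtype.val 0
  have hae : ∀ x : X, a (e x) = x := fun x => e.injective.extend_apply _ _ x
  have hav : ∀ i, a i = 0 ∨ a i ∈ X := fun i => by
    by_cases h : ∃ x, e x = i
    · obtain ⟨x, rfl⟩ := h
      exact Or.inr (by rw [hae]; exact x.2)
    · exact Or.inl (by simp [a, Function.extend_apply' _ _ _ h])
  have hsub : X ⊆ Set.range a := fun x hx => ⟨e ⟨x, hx⟩, hae ⟨x, hx⟩⟩
  refine ⟨a, ?_, ?_⟩
  · ext x
    rw [mem_convexHull_iff_inner_extremePoints_le_one h0, Set.mem_ofPred_eq]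
    constructor
    · intro h i
      rcases hav i with hi | hi
      · simp [hi]
      · exact h _ hi
    · intro h b hb
      obtain ⟨i, rfl⟩ := hsub hb
      exact h i
  · have hle : finsetPolar t ⊆ convexHull ℝ (Set.range a) := by
      rw [← convexHull_extremePoints_finsetPolar_dense h0, (hfin.isClosed_convexHull ℝ).closure_eq]
      exact convexHull_mono hsub
    exact interior_mono hle (zero_mem_interior_finsetPolar t)

end Polar

/-! ### Positive dependences -/

/-- If the origin is in the interior of the convex hull of a finite family, it is a convex
combination of the family with all weights positive. -/
theorem exists_pos_weights_of_zero_mem_interior {E : Type*} [NormedAddCommGroup E]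
    [NormedSpace ℝ E] {n : ℕ} {a : Fin n → E}
    (h0 : 0 ∈ interior (convexHull ℝ (Set.range a))) :
    ∃ p : Fin n → ℝ, (∀ i, 0 < p i) ∧ ∑ i, p i = 1 ∧ ∑ i, p i • a i = 0 := by
  -- a small negative multiple of `∑ aᵢ` is again in the convex hull
  obtain ⟨ε, hε, hmem⟩ : ∃ ε : ℝ, 0 < ε ∧ -ε • ∑ i, a i ∈ convexHull ℝ (Set.range a) := by
    have hc : ContinuousAt (fun ε : ℝ => -ε • ∑ i, a i) 0 := by fun_prop
    have hev := hc.eventually (by simpa using mem_interior_iff_mem_nhds.1 h0 :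
      ∀ᶠ x in nhds (-(0 : ℝ) • ∑ i, a i), x ∈ convexHull ℝ (Set.range a))
    obtain ⟨r, hr, hball⟩ := Metric.eventually_nhds_iff_ball.1 hev
    exact ⟨r / 2, by positivity,
      hball (r / 2) (by rw [mem_ball_zero_iff, Real.norm_of_nonneg] <;> linarith)⟩
  have himage : Set.range a =
      Fintype.linearCombination ℝ a '' Set.range (fun i : Fin n => Pi.single i (1 : ℝ)) := by
    rw [← Set.range_comp]
    congr 1
    ext i
    simp
  rw [himage, ← LinearMap.image_convexHull, convexHull_rangle_single_eq_stdSimplex] at hmem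
  obtain ⟨w, ⟨hw0, hw1⟩, hw⟩ := hmem
  rw [Fintype.linearCombination_apply] at hw
  have hpos : 0 < 1 + ε * n := by positivity
  refine ⟨fun i => (1 + ε * n)⁻¹ * (w i + ε), fun i => ?_, ?_, ?_⟩
  · have := hw0 i
    positivity
  · rw [← Finset.mul_sum, Finset.sum_add_distrib, hw1]
    simp only [Finset.sum_const, Finset.card_univ, Fintype.card_fin, nsmul_eq_mul]
    rw [mul_comm ε, inv_mul_cancel₀ (by linarith [mul_comm ε (n : ℝ)])]
  · simp only [mul_smul, add_smul, ← Finset.smul_sum, Finset.sum_add_distrib, hw]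
    rw [neg_smul, neg_add_cancel, smul_zero]

theorem span_range_eq_top_of_zero_mem_interior {E : Type*} [NormedAddCommGroup E]
    [NormedSpace ℝ E] [FiniteDimensional ℝ E] {n : ℕ} {a : Fin n → E}
    (h0 : 0 ∈ interior (convexHull ℝ (Set.range a))) :
    Submodule.span ℝ (Set.range a) = ⊤ := by
  apply Submodule.eq_top_of_nonempty_interior'
  exact ⟨0, interior_mono (convexHull_min Submodule.subset_span (Submodule.convex _)) h0⟩

/-! ### Maximum likelihood estimation on an affine model -/

open Topology in
/-- Let `M` be the part of the affine space `p + V` in the nonnegative orthant, with `p` positive.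
By concavity of the logarithm, `p` maximizes the log-likelihood of `u` on `M` exactly when the
gradient of `ℓ_u` at `p` is orthogonal to `V`. -/
theorem isMaxOn_logLikelihood_iff {n : ℕ} (V : Submodule ℝ (Fin n → ℝ)) {p u : Fin n → ℝ}
    (hp : ∀ i, 0 < p i) (hu : ∀ i, 0 ≤ u i) :
    IsMaxOn (logLikelihood u) {x | x - p ∈ V ∧ ∀ i, 0 ≤ x i} p ↔
      ∀ v ∈ V, ∑ i, u i * (v i / p i) = 0 := by
  have hsum : ∀ f : Fin n → ℝ, ((∑ i, f i : ℝ) : EReal) = ∑ i, (f i : EReal) := fun f =>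
    map_sum (⟨⟨Real.toEReal, EReal.coe_zero⟩, EReal.coe_add⟩ : ℝ →+ EReal) f _
  have hpos : ∀ x : Fin n → ℝ, (∀ i, 0 < x i) →
      logLikelihood u x = ((∑ i, u i * Real.log (x i) : ℝ) : EReal) := fun x hx => by
    rw [logLikelihood, hsum]
    exact Finset.sum_congr rfl fun i _ => by rw [ENNReal.log_ofReal_of_pos (hx i), EReal.coe_mul]
  constructor
  · intro hmax v hv
    have hlin : ∀ i, HasDerivAt (fun s : ℝ => p i + s * v i) (v i) 0 := fun i => by
      simpa using ((hasDerivAt_id (0 : ℝ)).mul_const (v i)).const_add (p i)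
    have hder : HasDerivAt (fun s : ℝ => ∑ i, u i * Real.log (p i + s * v i))
        (∑ i, u i * (v i / p i)) 0 := by
      refine HasDerivAt.fun_sum fun i _ => ?_
      have := ((hlin i).log (by simpa using (hp i).ne')).const_mul (u i)
      simpa using this
    refine IsLocalMax.hasDerivAt_eq_zero ?_ hder
    have hev : ∀ᶠ s in 𝓝 (0 : ℝ), ∀ i, 0 < p i + s * v i := by
      rw [Filter.eventually_all]
      intro i
      exact (hlin i).continuousAt.eventually_const_lt (by simpa using hp i)
    filter_upwards [hev] with s hs
    have h := hmax (a := fun i => p i + s * v i) ⟨by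
      have : (fun i => p i + s * v i) - p = s • v := by ext i; simp
      rw [this]
      exact V.smul_mem s hv, fun i => (hs i).le⟩
    simp only [Set.mem_ofPred_eq] at h
    rw [hpos _ hs, hpos _ hp, EReal.coe_le_coe_iff] at h
    simpa using h
  · rintro h x ⟨hx, hx0⟩
    change logLikelihood u x ≤ logLikelihood u p
    have hterm : ∀ i, (u i : EReal) * ENNReal.log (ENNReal.ofReal (x i)) ≤
        ((u i * Real.log (p i) + u i * ((x - p) i / p i) : ℝ) : EReal) := fun i => by
      rcases (hx0 i).eq_or_lt with h0 | h0
      · rcases (hu i).eq_or_lt with hu0 | hu0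
        · simp [← hu0]
        · rw [← h0, ENNReal.ofReal_zero, ENNReal.log_zero, EReal.coe_mul_bot_of_pos hu0]
          exact bot_le
      · rw [ENNReal.log_ofReal_of_pos h0, ← EReal.coe_mul, EReal.coe_le_coe_iff, ← mul_add]
        refine mul_le_mul_of_nonneg_left ?_ (hu i)
        have h1 := Real.log_le_sub_one_of_pos (div_pos h0 (hp i))
        rw [Real.log_div h0.ne' (hp i).ne'] at h1
        rw [Pi.sub_apply, sub_div, div_self (hp i).ne']
        linarith
    calc logLikelihood u x ≤ ∑ i, ((u i * Real.log (p i) + u i * ((x - p) i / p i) : ℝ) : EReal) :=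
          Finset.sum_le_sum fun i _ => hterm i
      _ = logLikelihood u p := by
          rw [hpos p hp, ← hsum, Finset.sum_add_distrib, h _ hx, add_zero]

/-! ### The logarithmic Voronoi cell attached to a vector configuration -/

section Configuration

open scoped InnerProductSpace

variable {E : Type*} [NormedAddCommGroup E] [InnerProductSpace ℝ E] {n : ℕ}

/-- The linear map sending `v` to the pair `(∑ vᵢ, ∑ vᵢ aᵢ)`. Its kernel is the space of affine
dependences of the configuration `a`. -/
noncomputable def affineDependenceMap (a : Fin n → E) : (Fin n → ℝ) →ₗ[ℝ] ℝ × E :=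
  (Fintype.linearCombination ℝ (fun _ => (1 : ℝ))).prod (Fintype.linearCombination ℝ a)

theorem affineDependenceMap_apply (a : Fin n → E) (v : Fin n → ℝ) :
    affineDependenceMap a v = (∑ i, v i, ∑ i, v i • a i) := by
  simp [affineDependenceMap, Fintype.linearCombination_apply]

/-- The affine map `y ↦ (pᵢ (1 - ⟪y, aᵢ⟫))ᵢ`, which records the slacks of `y` with respect to the
inequalities `⟪y, aᵢ⟫ ≤ 1`, scaled by the weights `p`. -/
noncomputable def slackMap (p : Fin n → ℝ) (a : Fin n → E) : E →ᵃ[ℝ] (Fin n → ℝ) :=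
  AffineMap.const ℝ E p - (LinearMap.pi fun i => p i • (innerₗ E (a i))).toAffineMap

theorem slackMap_apply (p : Fin n → ℝ) (a : Fin n → E) (y : E) (i : Fin n) :
    slackMap p a y i = p i * (1 - ⟪y, a i⟫_ℝ) := by
  simp [slackMap, real_inner_comm, mul_sub]

/-- A functional `w` that vanishes on the affine dependences of `a` is the restriction of an affine
function to the configuration. -/
theorem exists_eq_add_inner_of_vanish_on_ker [FiniteDimensional ℝ E] (a : Fin n → E)
    (w : Fin n → ℝ) (h : ∀ v ∈ LinearMap.ker (affineDependenceMap a), ∑ i, w i * v i = 0) :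
    ∃ (t : ℝ) (y : E), ∀ i, w i = t + ⟪y, a i⟫_ℝ := by
  let φ : Module.Dual ℝ (Fin n → ℝ) := Fintype.linearCombination ℝ w
  have hφ : ∀ v, φ v = ∑ i, w i * v i := fun v => by
    simp [φ, Fintype.linearCombination_apply, mul_comm]
  have hmem : φ ∈ LinearMap.range (affineDependenceMap a).dualMap := by
    rw [LinearMap.range_dualMap_eq_dualAnnihilator_ker, Submodule.mem_dualAnnihilator]
    exact fun v hv => (hφ v).trans (h v hv)
  obtain ⟨ψ, hψ⟩ := hmem
  refine ⟨ψ (1, 0), (InnerProductSpace.toDual ℝ E).symm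
    (LinearMap.toContinuousLinearMap (ψ ∘ₗ LinearMap.inr ℝ ℝ E)), fun i => ?_⟩
  have h1 : φ (Pi.single i 1) = w i := by simp [φ]
  have h2 : affineDependenceMap a (Pi.single i 1) = (1, a i) := by
    simp [affineDependenceMap]
  rw [← h1, ← hψ, LinearMap.dualMap_apply, h2, InnerProductSpace.toDual_symm_apply]
  simp [← map_add]

/-- If `p` is a positive probability vector with `∑ pᵢ aᵢ = 0`, the logarithmic Voronoi cell at `p`
of the model with direction space the affine dependences of `a` is affinely isomorphic to the
polyhedron `{y | ∀ i, ⟪y, aᵢ⟫ ≤ 1}`. -/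
theorem logVoronoi_eq_image_slackMap [FiniteDimensional ℝ E] (a : Fin n → E) {p : Fin n → ℝ}
    (hp : ∀ i, 0 < p i) (hp1 : ∑ i, p i = 1) (hpa : ∑ i, p i • a i = 0) :
    logVoronoi {x | x - p ∈ LinearMap.ker (affineDependenceMap a) ∧ ∀ i, 0 ≤ x i} p =
      slackMap p a '' {y | ∀ i, ⟪y, a i⟫_ℝ ≤ 1} := by
  have hpy : ∀ y : E, ∑ i, p i * ⟪y, a i⟫_ℝ = 0 := fun y => by
    have := congrArg (fun z => ⟪y, z⟫_ℝ) hpa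
    simpa [inner_sum, inner_smul_right] using this
  ext u
  constructor
  · rintro ⟨⟨hu0, hu1⟩, -, hmax⟩
    rw [isMaxOn_logLikelihood_iff _ hp hu0] at hmax
    obtain ⟨t, y, hty⟩ := exists_eq_add_inner_of_vanish_on_ker a (fun i => u i / p i)
      fun v hv => by rw [← hmax v hv]; exact Finset.sum_congr rfl fun i _ => by ring
    have hui : ∀ i, u i = p i * (t + ⟪y, a i⟫_ℝ) := fun i => by
      rw [← hty i, mul_div_cancel₀ _ (hp i).ne']
    have ht : t = 1 := by
      rw [← hu1, Finset.sum_congr rfl fun i _ => hui i]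
      simp_rw [mul_add]
      rw [Finset.sum_add_distrib, ← Finset.sum_mul, hp1, hpy]
      ring
    subst ht
    refine ⟨-y, fun i => ?_, ?_⟩
    · have := hu0 i
      rw [hui i] at this
      have := nonneg_of_mul_nonneg_right this (hp i)
      rw [inner_neg_left]
      linarith
    · ext i
      rw [slackMap_apply, hui i, inner_neg_left, sub_neg_eq_add]
  · rintro ⟨y, hy, rfl⟩
    have hu0 : ∀ i, 0 ≤ slackMap p a y i := fun i => by
      rw [slackMap_apply]
      exact mul_nonneg (hp i).le (sub_nonneg.2 (hy i))
    refine ⟨⟨hu0, ?_⟩, ⟨by simp, fun i => (hp i).le⟩, ?_⟩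
    · simp_rw [slackMap_apply, mul_sub, mul_one]
      rw [Finset.sum_sub_distrib, hp1, hpy, sub_zero]
    · rw [isMaxOn_logLikelihood_iff _ hp hu0]
      intro v hv
      rw [LinearMap.mem_ker, affineDependenceMap_apply, Prod.mk_eq_zero] at hv
      have hvy : ∑ i, v i * ⟪y, a i⟫_ℝ = 0 := by
        have := congrArg (fun z => ⟪y, z⟫_ℝ) hv.2
        simpa [inner_sum, inner_smul_right] using this
      have : ∀ i, slackMap p a y i * (v i / p i) = v i - v i * ⟪y, a i⟫_ℝ := fun i => by
        rw [slackMap_apply]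
        field_simp [(hp i).ne']
      rw [Finset.sum_congr rfl fun i _ => this i, Finset.sum_sub_distrib, hv.1, hvy, sub_zero]

theorem slackMap_injective {p : Fin n → ℝ} (hp : ∀ i, 0 < p i) {a : Fin n → E}
    (ha : Submodule.span ℝ (Set.range a) = ⊤) : Function.Injective (slackMap p a) := by
  intro y z h
  have h1 : ∀ i, ⟪a i, y - z⟫_ℝ = 0 := fun i => by
    have := congrFun h i
    rw [slackMap_apply, slackMap_apply] at this
    have := mul_left_cancel₀ (hp i).ne' this
    rw [inner_sub_right, real_inner_comm, real_inner_comm z]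
    linarith
  have h2 : y - z ∈ (Submodule.span ℝ (Set.range a))ᗮ := by
    rw [Submodule.mem_orthogonal]
    intro w hw
    induction hw using Submodule.span_induction with
    | mem w hw => obtain ⟨i, rfl⟩ := hw; exact h1 i
    | zero => simp
    | add w w' _ _ h h' => rw [inner_add_left, h, h', add_zero]
    | smul c w _ h => rw [inner_smul_left, h, mul_zero]
  rw [ha, Submodule.top_orthogonal_eq_bot, Submodule.mem_bot] at h2
  exact sub_eq_zero.1 h2

theorem affineDependenceMap_surjective {p : Fin n → ℝ} {a : Fin n → E}
    (hp1 : ∑ i, p i = 1) (hpa : ∑ i, p i • a i = 0)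
    (ha : Submodule.span ℝ (Set.range a) = ⊤) :
    Function.Surjective (affineDependenceMap a) := by
  rintro ⟨t, y⟩
  have hy : y ∈ Submodule.span ℝ (Set.range a) := ha ▸ Submodule.mem_top
  obtain ⟨c, hc⟩ := (Submodule.mem_span_range_iff_exists_fun ℝ).1 hy
  -- adding a multiple of `p` adjusts the coefficient sum and leaves the combination unchanged
  refine ⟨c + (t - ∑ i, c i) • p, ?_⟩
  rw [affineDependenceMap_apply, Prod.mk.injEq]
  constructor
  · simp [Finset.sum_add_distrib, ← Finset.mul_sum, hp1]
  · simp only [Pi.add_apply, Pi.smul_apply, smul_eq_mul, add_smul, mul_smul,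
      Finset.sum_add_distrib, ← Finset.smul_sum, hpa, hc, smul_zero, add_zero]

theorem isLinearModel_affineDependences [FiniteDimensional ℝ E] {d : ℕ} {p : Fin n → ℝ}
    {a : Fin n → E} (hn : Module.finrank ℝ E + d + 1 = n) (hp : ∀ i, 0 < p i)
    (hp1 : ∑ i, p i = 1) (hpa : ∑ i, p i • a i = 0)
    (ha : Submodule.span ℝ (Set.range a) = ⊤) :
    IsLinearModel d {x | x - p ∈ LinearMap.ker (affineDependenceMap a) ∧ ∀ i, 0 ≤ x i} := by
  set K := LinearMap.ker (affineDependenceMap a) with hK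
  have hdim : Module.finrank ℝ K = d := by
    have h := LinearMap.finrank_range_add_finrank_ker (affineDependenceMap a)
    rw [LinearMap.range_eq_top.2 (affineDependenceMap_surjective hp1 hpa ha), finrank_top,
      Module.finrank_prod, Module.finrank_self, Module.finrank_fin_fun, ← hK] at h
    omega
  have e : (Fin d → ℝ) ≃ₗ[ℝ] K := LinearEquiv.ofFinrankEq _ _ (by simp [hdim])
  let f : (Fin d → ℝ) →ᵃ[ℝ] (Fin n → ℝ) :=
    (K.subtype ∘ₗ e.toLinearMap).toAffineMap + AffineMap.const ℝ _ p
  have hf : ∀ θ, f θ = (e θ : Fin n → ℝ) + p := fun θ => rfl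
  refine ⟨f, fun θ η h => by simpa [hf] using h, fun θ => ?_, ⟨0, fun i => ?_⟩, ?_⟩
  · have h : ((e θ : K) : Fin n → ℝ) ∈ K := (e θ).2
    replace h := LinearMap.mem_ker.1 h
    rw [affineDependenceMap_apply, Prod.mk_eq_zero] at h
    simp [hf, Finset.sum_add_distrib, h.1, hp1]
  · simpa [hf] using hp i
  · ext x
    constructor
    · rintro ⟨hx, hx0⟩
      have hfx : f (e.symm ⟨x - p, hx⟩) = x := by simp [hf]
      exact ⟨e.symm ⟨x - p, hx⟩, by simpa only [Set.mem_ofPred_eq, hfx] using hx0, hfx⟩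
    · rintro ⟨θ, hθ, rfl⟩
      exact ⟨by simp [hf], hθ⟩

end Configuration

/-! ### Realizing polytopes as logarithmic Voronoi cells -/

theorem mainTheorem3 (n d m : ℕ) (P : Set (Fin m → ℝ)) (hP : IsPolytope P)
    (hdim : polyDim P + d + 1 = n)
    (hfacets : {F : Set (Fin m → ℝ) | IsPolyFacet P F}.encard ≤ n) :
    ∃ M : Set (Fin n → ℝ), IsLinearModel d M ∧
      ∃ p ∈ M, (∀ i, 0 < p i) ∧ IsPolytope (logVoronoi M p) ∧ CombEquiv P (logVoronoi M p) := by
  obtain ⟨g, t, hg, hPg, h0⟩ := hP.exists_fullDimensional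
  have hfacets' := encard_facets_le_affineImage g hg (convexHull ℝ (t : Set _))
  rw [← hPg] at hfacets'
  obtain ⟨a, hta, ha0⟩ := exists_inequalities h0 (by omega) (hfacets'.trans hfacets)
  obtain ⟨p, hp, hp1, hpa⟩ := exists_pos_weights_of_zero_mem_interior ha0
  have hspan := span_range_eq_top_of_zero_mem_interior ha0
  refine ⟨{x | x - p ∈ LinearMap.ker (affineDependenceMap a) ∧ ∀ i, 0 ≤ x i},
    isLinearModel_affineDependences (by rwa [finrank_euclideanSpace_fin]) hp hp1 hpa hspan, p,
    ⟨by simp, fun i => (hp i).le⟩, hp, ?_⟩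
  rw [logVoronoi_eq_image_slackMap a hp hp1 hpa, ← hta]
  have ht : t.Nonempty := by
    rw [← Finset.coe_nonempty, ← convexHull_nonempty_iff (𝕜 := ℝ)]
    exact ⟨0, interior_subset h0⟩
  refine ⟨IsPolytope.affineImage ⟨t, ht, rfl⟩ _, ?_⟩
  have h1 := combEquiv_affineImage g hg (convexHull ℝ (t : Set _))
  rw [← hPg] at h1
  exact h1.symm.trans (combEquiv_affineImage _ (slackMap_injective hp hspan) _)
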